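/- Let $I$ be an infinite set and let $P$ be the poset of finite subsets of $I$ ordered by reverse inclusion ($p \le q$ iff $q \subseteq p$), regarded as a category with a unique morphism $p \to q$ whenever $p \le q$. Let $X$ be the poset of filters on $P$ (nonempty, downward directed, upward closed subsets), ordered by inclusion, and put $\mathbf{p} = |P|$. Grothendieck topologies $J$ on $P$ are identified with the subtoposes $\mathsf{Sh}(P,J) \subseteq \mathsf{PSh}(P)$. Let $\mathbf{gt}$ be the number of Grothendieck topologies on $P$, and let $\mathbf{cl}$, $\mathbf{coh}$, $\mathbf{ep}$ be the numbers of those $J$ for which $\mathsf{Sh}(P,J)$ is, respectively, a closed subtopos of $\mathsf{PSh}(P)$, a coherent subtopos of $\mathsf{PSh}(P)$, a topos with enough points. Here: - $\mathsf{Sh}(P,J)$ is *closed* if there is a subterminal object $U$ of $\mathsf{PSh}(P)$ such that the sheaves are exactly the presheaves $F$ for which the projection $F\times U\to U$ is an isomorphism. - An object of a topos is *compact* if every epimorphic family with that codomain contains a finite epimorphic subfamily; it is *coherent* if it is compact and the pullback of any two maps to it from compact objects is compact. A topos is *coherent* if it has a full subcategory of compact generators that is closed under finite limits. $\mathsf{Sh}(P,J)$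 is a *coherent subtopos* of $\mathsf{PSh}(P)$ if both toposes are coherent and sheafification $\mathsf{PSh}(P)\to\mathsf{Sh}(P,J)$ preserves coherent objects. Then: 1. The map $x \mapsto \bigcup_{p \in x} p$ is an order isomorphism from $X$ to the power set $\mathcal{P}(I)$ ordered by inclusion, and $|X| = 2^{\mathbf{p}}$. 2. $\mathbf{cl} = \mathbf{coh} = 2^{\mathbf{p}}$. 3. $\mathbf{ep} = \mathbf{gt} = 2^{2^{\mathbf{p}}}$. 4. $\mathcal{P}(I)$ contains an antichain (for inclusion) of cardinality $2^{\mathbf{p}}$. 5. Every upward closed subset of $X$ is closed in the strong topology, i.e. the topology on $X$ generated by the sets that are locally closed for the Scott topology. -/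

import Mathlib

open CategoryTheory CategoryTheory.Limits Cardinal Topology

universe w v u

/-! ### Coherent toposes and coherent subtoposes -/

section Coherent

variable {E : Type w} [Category.{v} E]

/-- The family `f` of morphisms with codomain `X` is epimorphic. -/
def EpimorphicFamily {ι : Type*} {Y : ι → E} {X : E} (f : ∀ i, Y i ⟶ X) : Prop :=
  ∀ ⦃Z : E⦄ (g h : X ⟶ Z), (∀ i, f i ≫ g = f i ≫ h) → g = h

/-- `X` is compact: every epimorphic family with codomain `X` contains a finite epimorphic
subfamily. -/
def IsCompactObject (X : E) : Prop :=
  ∀ ⦃ι : Type v⦄ (Y : ι → E) (f : ∀ i, Y i ⟶ X), EpimorphicFamily f →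
    ∃ s : Finset ι, EpimorphicFamily (fun i : s => f i)

/-- `X` is coherent: it is compact, and the pullback of any two morphisms from compact objects
to `X` is compact. -/
def IsCoherentObject (X : E) : Prop :=
  IsCompactObject X ∧
    ∀ ⦃Q Y Z : E⦄ (a : Q ⟶ Y) (b : Q ⟶ Z) (f : Y ⟶ X) (g : Z ⟶ X),
      IsPullback a b f g → IsCompactObject Y → IsCompactObject Z → IsCompactObject Q

variable (E) in
/-- The topos `E` is coherent: it has a full subcategory `K` of compact generators which is
closed under finite limits. -/
def IsCoherentTopos : Prop :=
  ∃ K : ObjectProperty E,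
    (∀ X, K X → IsCompactObject X) ∧
    K.IsSeparating ∧
    ∀ (D : Type) [SmallCategory D] [FinCategory D], K.IsClosedUnderLimitsOfShape D

end Coherent

section Subtopos

variable {C : Type u} [SmallCategory C]

/-- The subtopos `Sh(C, J)` of `PSh(C)` is a coherent subtopos: `PSh(C)` and `Sh(C, J)` are coherent
toposes, and the inverse image functor of the inclusion, which is sheafification, preserves
coherent objects. -/
def IsCoherentSubtopos (J : GrothendieckTopology C) : Prop :=
  IsCoherentTopos (Cᵒᵖ ⥤ Type u) ∧ IsCoherentTopos (Sheaf J (Type u)) ∧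
    ∀ F : Cᵒᵖ ⥤ Type u, IsCoherentObject F →
      IsCoherentObject ((presheafToSheaf J (Type u)).obj F)

/-- The subtopos `Sh(C, J)` of `PSh(C)` is a closed subtopos: it is the closed complement of the
open subtopos given by some subterminal object `U`, that is, its objects are the presheaves `F`
for which the projection `F × U ⟶ U` is an isomorphism. -/
def IsClosedSubtopos (J : GrothendieckTopology C) : Prop :=
  ∃ U : Cᵒᵖ ⥤ Type u, Mono (terminal.from U) ∧
    ∀ F : Cᵒᵖ ⥤ Type u, Presheaf.IsSheaf J F ↔ IsIso (prod.snd : F ⨯ U ⟶ U)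

end Subtopos

/-- The strong topology associated to a topology `t` on `X`: its basis is formed by the sets that are
locally closed for `t`. -/
abbrev strongTopology {X : Type*} (t : TopologicalSpace X) : TopologicalSpace X :=
  TopologicalSpace.generateFrom {s | @IsLocallyClosed X t s}

/-- The poset of finite subsets of `I` under reverse inclusion, viewed as a category with a unique
morphism `p ⟶ q` whenever `p ≤ q`. -/
abbrev FinSubsetsRev (I : Type u) : Type u := (Finset I)ᵒᵈ

/-! ### Filters of finite sets, and large antichains. -/

section FiniteSubsets

variable {I : Type u}

/-! Under reverse inclusion a filter is a family of finite sets closed under subsets and finite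
unions, hence consists of all finite subsets of its union. Filters are thus subsets of `I`, and
since `I` is infinite, `P` has as many elements as `I`.

A topology is a set of pairs (object, sieve), which bounds `gt` by a double exponential
(`mk_grothendieckTopology_le`). The bound is attained already with enough points: each set `S` of
filters induces a topology having the members of `S` as a conservative family of points, and
distinct subsets of one antichain of filters induce distinct topologies
(`filterTopology_injOn_powerset`). An antichain of maximal size exists in the power set of `I`.

Closed subtoposes correspond to lower sets of `P` (`isClosedSubtopos_iff`), and there are as many of
these as subsets of `P`.

Coherent subtoposes correspond to topologies in which every cover has a finitely generated subcover
(`isCoherentSubtopos_iff`). Such a topology is determined by a set of pairs (finite set, element),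
so there are at most `2 ^ #P`; closed topologies are of this kind and give the reverse bound. The
equivalence rests on the fact that, for these topologies, compact sheaves are the locally finitely
generated ones (`IsSheafModel.isCompactObject_iff`). -/

theorem mem_pfilter_finSubsetsRev_iff (x : Order.PFilter (FinSubsetsRev I))
    (p : FinSubsetsRev I) :
    p ∈ x ↔ ∀ i ∈ OrderDual.ofDual p, ∃ q ∈ x, i ∈ OrderDual.ofDual q := by
  classical
  refine ⟨fun hp i hi => ⟨p, hp, hi⟩, ?_⟩
  suffices h : ∀ s : Finset I, (∀ i ∈ s, ∃ q ∈ x, i ∈ OrderDual.ofDual q) →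
      OrderDual.toDual s ∈ x from h _
  intro s
  induction s using Finset.induction_on with
  | empty =>
    intro _
    obtain ⟨q, hq⟩ := x.nonempty
    exact Order.PFilter.mem_of_le (Finset.empty_subset (OrderDual.ofDual q)) hq
  | insert a s _ ih =>
    intro h
    obtain ⟨q, hq, haq⟩ := h a (Finset.mem_insert_self _ _)
    obtain ⟨r, hr, hqr, hsr⟩ := x.directed q hq _
      (ih fun i hi => h i (Finset.mem_insert_of_mem hi))
    exact Order.PFilter.mem_of_le (x := r) (Finset.insert_subset (hqr haq) hsr) hr

/-- The filter of finite subsets of `A`. -/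
def finSubsetsPFilter (A : Set I) : Order.PFilter (FinSubsetsRev I) :=
  Order.IsPFilter.toPFilter (F := {p : FinSubsetsRev I | ∀ i ∈ OrderDual.ofDual p, i ∈ A})
    (Order.IsPFilter.of_def ⟨OrderDual.toDual ∅, by simp⟩
      (by
        classical
        intro p hp q hq
        refine ⟨OrderDual.toDual (OrderDual.ofDual p ∪ OrderDual.ofDual q), ?_, ?_, ?_⟩
        · intro i hi
          exact (Finset.mem_union.1 hi).elim (hp i) (hq i)
        · exact Finset.subset_union_left (s₁ := OrderDual.ofDual p)
        · exact Finset.subset_union_right (s₁ := OrderDual.ofDual p))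
      (fun hpq hp i hi => hp i (hpq hi)))

theorem mem_finSubsetsPFilter {A : Set I} {p : FinSubsetsRev I} :
    p ∈ finSubsetsPFilter A ↔ ∀ i ∈ OrderDual.ofDual p, i ∈ A :=
  Iff.rfl

/-- Filters of finite subsets of `I` under reverse inclusion correspond to subsets of `I`. -/
def pfilterFinSubsetsRevIso (I : Type u) : Order.PFilter (FinSubsetsRev I) ≃o Set I where
  toFun x := {i | ∃ p ∈ x, i ∈ OrderDual.ofDual p}
  invFun := finSubsetsPFilter
  left_inv x := by
    apply SetLike.ext
    intro p
    rw [mem_pfilter_finSubsetsRev_iff x, mem_finSubsetsPFilter]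
    rfl
  right_inv A := by
    ext i
    constructor
    · rintro ⟨p, hp, hi⟩
      exact hp i hi
    · intro hi
      refine ⟨OrderDual.toDual {i}, ?_, by simp⟩
      intro j hj
      obtain rfl : j = i := by simpa using hj
      exact hi
  map_rel_iff' := by
    intro x y
    constructor
    · intro h p hp
      exact (mem_pfilter_finSubsetsRev_iff y p).2 fun i hi => h ⟨p, hp, hi⟩
    · rintro h i ⟨p, hp, hi⟩
      exact ⟨p, h hp, hi⟩

theorem mk_finSubsetsRev [Infinite I] : #(FinSubsetsRev I) = #I :=
  mk_finset_of_infinite I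

theorem mk_pfilter_finSubsetsRev [Infinite I] :
    #(Order.PFilter (FinSubsetsRev I)) = (2 : Cardinal.{u}) ^ #(FinSubsetsRev I) := by
  rw [Cardinal.mk_congr (pfilterFinSubsetsRevIso I).toEquiv, mk_set, mk_finSubsetsRev]

/-- An infinite set has as large an antichain of subsets as it has subsets. -/
theorem exists_isAntichain_mk_eq (I : Type u) [Infinite I] :
    ∃ A : Set (Set I), IsAntichain (· ⊆ ·) A ∧ #A = (2 : Cardinal.{u}) ^ #I := by
  have h : #(I ⊕ I) = #I := by simp
  obtain ⟨e⟩ := Cardinal.eq.1 h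
  -- `B` is paired with its complement in a second copy of `I`: an inclusion then holds in both
  -- directions at once and forces equality.
  let f : Set I → Set I := fun B => e '' (Sum.inl '' B ∪ Sum.inr '' Bᶜ)
  have hf : ∀ B C, f B ⊆ f C → B = C := by
    intro B C hBC
    have h' := (Set.image_subset_image_iff e.injective).1 hBC
    ext i
    constructor
    · intro hi
      simpa using h' (Or.inl ⟨i, hi, rfl⟩)
    · intro hi
      by_contra hn
      have := h' (Or.inr ⟨i, hn, rfl⟩)
      simp [hi] at this
  refine ⟨Set.range f, ?_, ?_⟩
  · rintro _ ⟨B, rfl⟩ _ ⟨C, rfl⟩ hne hle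
    exact hne (congrArg f (hf B C hle))
  · rw [mk_range_eq f fun B C h => hf B C h.le, mk_set]

end FiniteSubsets

/-- Every upper set is closed in the strong topology of the Scott topology. -/
theorem IsUpperSet.isClosed_strongTopology_scott {X : Type*} [Preorder X] {S : Set X}
    (hS : IsUpperSet S) :
    IsClosed[strongTopology (Topology.scott X Set.univ)] S := by
  let := strongTopology (Topology.scott X Set.univ)
  -- The complement is a union of principal lower sets. Each is Scott closed, hence locally closed,
  -- hence strongly open.
  have hU : Sᶜ = ⋃ a ∈ Sᶜ, Set.Iic a := by
    ext b
    simp only [Set.mem_iUnion, Set.mem_Iic, exists_prop]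
    exact ⟨fun hb => ⟨b, hb, le_rfl⟩, fun ⟨a, ha, hba⟩ hb => ha (hS hba hb)⟩
  refine ⟨?_⟩
  rw [hU]
  refine isOpen_biUnion fun a _ => ?_
  refine TopologicalSpace.isOpen_generateFrom_of_mem ?_
  let := Topology.scott X Set.univ
  have : Topology.IsScott X Set.univ := ⟨rfl⟩
  exact (isClosed_Iic (a := a)).isLocallyClosed

/-! ### Topologies induced by sets of filters. -/

section FilterTopology

variable {P : Type u} [Preorder P]

/-- The Grothendieck topology induced by a set `S` of filters: a sieve is covering when it meets
every filter of `S` which contains its target. -/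
def filterTopology (S : Set (Order.PFilter P)) : GrothendieckTopology P where
  sieves p := {R | ∀ x ∈ S, p ∈ x → ∃ (q : P) (f : q ⟶ p), R f ∧ q ∈ x}
  top_mem' p x _ hp := ⟨p, 𝟙 p, trivial, hp⟩
  pullback_stable' p q R f hR x hx hq := by
    obtain ⟨r, g, hg, hr⟩ := hR x hx (Order.PFilter.mem_of_le (leOfHom f) hq)
    obtain ⟨s, hs, hsq, hsr⟩ := x.directed q hq r hr
    exact ⟨s, homOfLE hsq, R.downward_closed hg (homOfLE hsr), hs⟩
  transitive' p R hR T hT x hx hp := by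
    obtain ⟨q, f, hf, hq⟩ := hR x hx hp
    obtain ⟨r, g, hg, hr⟩ := hT hf x hx hq
    exact ⟨r, g ≫ f, hg, hr⟩

/-- The indicator functor of a filter. -/
def Order.PFilter.indicatorFunctor (x : Order.PFilter P) : P ⥤ Type u where
  obj p := ULift (PLift (p ∈ x))
  map f := ↾fun h => ⟨⟨Order.PFilter.mem_of_le (leOfHom f) h.down.down⟩⟩

instance (x : Order.PFilter P) : IsCofiltered x.indicatorFunctor.Elements where
  nonempty := by
    obtain ⟨p, hp⟩ := x.nonempty
    exact ⟨⟨p, ⟨⟨hp⟩⟩⟩⟩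
  cone_objs := by
    rintro ⟨p, ⟨⟨hp⟩⟩⟩ ⟨q, ⟨⟨hq⟩⟩⟩
    obtain ⟨r, hr, hrp, hrq⟩ := x.directed p hp q hq
    exact ⟨⟨r, ⟨⟨hr⟩⟩⟩, ⟨homOfLE hrp, rfl⟩, ⟨homOfLE hrq, rfl⟩, trivial⟩
  cone_maps a b f g := ⟨a, 𝟙 a, by
    have : f = g := Subtype.ext (Subsingleton.elim _ _)
    rw [this]⟩

/-- The point of `filterTopology S` given by a filter in `S`. -/
def filterTopologyPoint {S : Set (Order.PFilter P)} (x : S) :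
    GrothendieckTopology.Point.{u} (filterTopology S) where
  fiber := x.1.indicatorFunctor
  initiallySmall := initiallySmall_of_essentiallySmall _
  jointly_surjective := by
    rintro p R hR ⟨⟨hp⟩⟩
    obtain ⟨q, f, hf, hq⟩ := hR x.1 x.2 hp
    exact ⟨q, f, hf, ⟨⟨hq⟩⟩, rfl⟩

/-- A sieve that is jointly surjective on the fibers of all points from `S` meets every filter of
`S` containing its target, which is the definition of covering; so these points are conservative. -/
theorem filterTopology_hasEnoughPoints (S : Set (Order.PFilter P)) :
    GrothendieckTopology.HasEnoughPoints.{u} (filterTopology S) where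
  exists_objectProperty := by
    refine ⟨ObjectProperty.ofObj (fun x : S => filterTopologyPoint x), inferInstance, ?_⟩
    refine ObjectProperty.IsConservativeFamilyOfPoints.mk' fun p R h x hx hp => ?_
    obtain ⟨q, f, hf, ⟨⟨hq⟩⟩, _⟩ :=
      h ⟨filterTopologyPoint ⟨x, hx⟩, ObjectProperty.ofObj_apply _ _⟩ ⟨⟨hp⟩⟩
    exact ⟨q, f, hf, hq⟩

/-- The sieve of the elements below `p` which are outside the filter `x`. -/
def Order.PFilter.complSieve (x : Order.PFilter P) (p : P) : Sieve p where
  arrows q _ := q ∉ x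
  downward_closed hq f hr := hq (Order.PFilter.mem_of_le (leOfHom f) hr)

/-- The filter `x` never meets this sieve. Any other `y` in the antichain has an element outside
`x`, and directedness of `y` moves it below `p`. The sieve therefore tests membership of `x` in `S`.
-/
theorem Order.PFilter.complSieve_mem_filterTopology_iff {A S : Set (Order.PFilter P)}
    (hA : IsAntichain (· ≤ ·) A) (hS : S ⊆ A) {x : Order.PFilter P} (hx : x ∈ A) {p : P}
    (hp : p ∈ x) : x.complSieve p ∈ filterTopology S p ↔ x ∉ S := by
  refine ⟨fun h hxS => ?_, fun h y hy hpy => ?_⟩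
  · obtain ⟨q, f, hf, hq⟩ := h x hxS hp
    exact hf hq
  · have hne : y ≠ x := fun e => h (e ▸ hy)
    obtain ⟨q, hqy, hqx⟩ := Set.not_subset.1 (hA (hS hy) hx hne)
    obtain ⟨r, hr, hrp, hrq⟩ := y.directed p hpy q hqy
    exact ⟨r, homOfLE hrp, fun hrx => hqx (Order.PFilter.mem_of_le hrq hrx), hr⟩

theorem filterTopology_injOn_powerset {A : Set (Order.PFilter P)} (hA : IsAntichain (· ≤ ·) A) :
    Set.InjOn filterTopology (𝒫 A) := by
  intro S hS T hT h
  ext x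
  by_cases hx : x ∈ A
  · obtain ⟨p, hp⟩ := x.nonempty
    rw [← not_iff_not, ← Order.PFilter.complSieve_mem_filterTopology_iff hA hS hx hp,
      ← Order.PFilter.complSieve_mem_filterTopology_iff hA hT hx hp, h]
  · exact iff_of_false (fun h => hx (hS h)) (fun h => hx (hT h))

variable (P) in
-- In a preorder a sieve is determined by the set of its sources, so each object has at most `2 ^
-- #P` sieves.
theorem mk_grothendieckTopology_le [Infinite P] :
    #(GrothendieckTopology P) ≤ (2 : Cardinal.{u}) ^ ((2 : Cardinal.{u}) ^ #P) := by
  have hsieve : ∀ p : P, #(Sieve p) ≤ 2 ^ #P := fun p => by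
    rw [← mk_set]
    refine mk_le_of_injective (f := fun R : Sieve p => {q | ∃ f : q ⟶ p, R f}) fun R T h => ?_
    ext q f
    have h' := Set.ext_iff.1 h q
    constructor
    · intro hf
      obtain ⟨g, hg⟩ := h'.1 ⟨f, hf⟩
      exact Subsingleton.elim g f ▸ hg
    · intro hf
      obtain ⟨g, hg⟩ := h'.2 ⟨f, hf⟩
      exact Subsingleton.elim g f ▸ hg
  calc #(GrothendieckTopology P) ≤ #(Set (Σ p : P, Sieve p)) := by
        refine mk_le_of_injective
          (f := fun J : GrothendieckTopology P => {R : Σ p : P, Sieve p | R.2 ∈ J R.1})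
          fun J K h => ?_
        ext p R
        exact Set.ext_iff.1 h ⟨p, R⟩
    _ = 2 ^ #(Σ p : P, Sieve p) := mk_set
    _ ≤ 2 ^ ((2 : Cardinal.{u}) ^ #P) := by
        refine power_le_power_left two_ne_zero ?_
        rw [mk_sigma]
        calc Cardinal.sum (fun p : P => #(Sieve p))
            ≤ Cardinal.sum (fun _ : P => (2 : Cardinal.{u}) ^ #P) := sum_le_sum _ _ hsieve
          _ = #P * 2 ^ #P := by simp
          _ ≤ 2 ^ #P * 2 ^ #P := mul_le_mul_left (cantor _).le _
          _ = 2 ^ #P := mul_eq_self ((aleph0_le_mk P).trans (cantor _).le)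

end FilterTopology

theorem mk_hasEnoughPoints_and_mk_grothendieckTopology (I : Type u) [Infinite I] :
    #{J : GrothendieckTopology (FinSubsetsRev I) //
        GrothendieckTopology.HasEnoughPoints.{u} J}
      = (2 : Cardinal.{u}) ^ ((2 : Cardinal.{u}) ^ #(FinSubsetsRev I)) ∧
    #(GrothendieckTopology (FinSubsetsRev I))
      = (2 : Cardinal.{u}) ^ ((2 : Cardinal.{u}) ^ #(FinSubsetsRev I)) := by
  have hle : #{J : GrothendieckTopology (FinSubsetsRev I) //
      GrothendieckTopology.HasEnoughPoints.{u} J} ≤ #(GrothendieckTopology (FinSubsetsRev I)) :=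
    mk_subtype_le _
  have : Infinite (FinSubsetsRev I) := inferInstanceAs (Infinite (Finset I))
  have hgt := mk_grothendieckTopology_le (FinSubsetsRev I)
  suffices h : (2 : Cardinal.{u}) ^ ((2 : Cardinal.{u}) ^ #(FinSubsetsRev I)) ≤
      #{J : GrothendieckTopology (FinSubsetsRev I) //
        GrothendieckTopology.HasEnoughPoints.{u} J} from
    ⟨(hle.trans hgt).antisymm h, hgt.antisymm (h.trans hle)⟩
  obtain ⟨A, hA, hcard⟩ := exists_isAntichain_mk_eq I
  let e := (pfilterFinSubsetsRevIso I).symm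
  have hA' : IsAntichain (· ≤ ·) (e '' A) := hA.image_relEmbedding e.toOrderEmbedding
  rw [mk_finSubsetsRev, ← hcard, ← mk_set]
  have hsub : ∀ B : Set A, e '' (Subtype.val '' B) ⊆ e '' A := fun B =>
    Set.image_mono (by rintro _ ⟨a, _, rfl⟩; exact a.2)
  refine mk_le_of_injective (f := fun B : Set A =>
    ⟨filterTopology (e '' (Subtype.val '' B)), filterTopology_hasEnoughPoints _⟩) fun B C h => ?_
  have := filterTopology_injOn_powerset hA' (hsub B) (hsub C) (congrArg Subtype.val h)
  exact Subtype.val_injective.image_injective (e.injective.image_injective this)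

/-! ### Closed subtoposes and lower sets. -/

section ClosedSubtopos

open Opposite

/-- The projection `F × U ⟶ U` is an isomorphism precisely when `F` is a singleton wherever `U` is
inhabited. -/
theorem isIso_prod_snd_iff {C : Type u} [SmallCategory C] (F U : Cᵒᵖ ⥤ Type u) :
    IsIso (prod.snd : F ⨯ U ⟶ U) ↔ ∀ c, Nonempty (U.obj c) → Nonempty (Unique (F.obj c)) := by
  constructor
  · rintro _ ⟨c⟩ ⟨t⟩
    let t' : yoneda.obj c ⟶ U := yonedaEquiv.symm t
    refine ⟨⟨⟨yonedaEquiv (t' ≫ inv prod.snd ≫ prod.fst)⟩, fun a => ?_⟩⟩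
    have h : prod.lift (yonedaEquiv.symm a) t' = t' ≫ inv (prod.snd : F ⨯ U ⟶ U) := by
      rw [IsIso.eq_comp_inv, prod.lift_snd]
    have h' := congrArg (· ≫ prod.fst) h
    simp only [prod.lift_fst, Category.assoc] at h'
    exact yonedaEquiv.symm_apply_eq.1 h'
  · intro h
    have key : ∀ {G : Cᵒᵖ ⥤ Type u} (_ : G ⟶ U) (f g : G ⟶ F), f = g := fun k f g => by
      ext c a
      obtain ⟨_⟩ := h c ⟨k.app c a⟩
      exact Subsingleton.elim _ _
    let m : U ⟶ F :=
      { app c := ↾fun a => (h c ⟨a⟩).some.default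
        naturality c d f := by
          ext a
          obtain ⟨_⟩ := h d ⟨U.map f a⟩
          exact Subsingleton.elim _ _ }
    refine ⟨prod.lift m (𝟙 U), ?_, prod.lift_snd _ _⟩
    apply prod.hom_ext
    · exact key prod.snd _ _
    · simp [prod.lift_snd]

variable {P : Type u} [Preorder P]

/-- The Grothendieck topology of the closed complement of the lower set `U`: a sieve on `p` is
covering when it is maximal or `p` belongs to `U`. -/
def closedTopology (U : LowerSet P) : GrothendieckTopology P where
  sieves p := {R | R = ⊤ ∨ p ∈ U}
  top_mem' _ := Or.inl rfl
  pullback_stable' p q R f hR := by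
    rcases hR with rfl | hp
    · exact Or.inl rfl
    · exact Or.inr (U.lower (leOfHom f) hp)
  transitive' p R hR T hT := by
    rcases hR with rfl | hp
    · simpa using hT (f := 𝟙 p) trivial
    · exact Or.inr hp

theorem bot_mem_closedTopology_iff {U : LowerSet P} {p : P} :
    (⊥ : Sieve p) ∈ closedTopology U p ↔ p ∈ U := by
  refine ⟨fun h => h.resolve_left fun h' => ?_, Or.inr⟩
  have : (⊥ : Sieve p) (𝟙 p) := h' ▸ trivial
  exact this

theorem closedTopology_injective :
    Function.Injective (closedTopology : LowerSet P → GrothendieckTopology P) := by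
  intro U V h
  ext p
  change p ∈ U ↔ p ∈ V
  rw [← bot_mem_closedTopology_iff, h, bot_mem_closedTopology_iff]

/-- The empty sieve covers each point of `U`, which forces a unique section there. Conversely, `U`
being a lower set, all gluing data below a point of `U` live in singletons. -/
theorem isSheaf_closedTopology_iff (U : LowerSet P) (F : Pᵒᵖ ⥤ Type u) :
    Presheaf.IsSheaf (closedTopology U) F ↔
      ∀ c, c.unop ∈ U → Nonempty (Unique (F.obj c)) := by
  rw [isSheaf_iff_isSheaf_of_type]
  constructor
  · rintro h ⟨p⟩ hp
    obtain ⟨a, -, ha⟩ := h (⊥ : Sieve p) (Or.inr hp) (fun _ _ h => h.elim)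
      (fun _ _ _ _ _ _ _ h => h.elim)
    exact ⟨⟨⟨a⟩, fun b => ha b fun _ _ h => h.elim⟩⟩
  · rintro h p R (rfl | hp)
    · exact Presieve.isSheafFor_top F
    · intro x _
      have h' : ∀ q, q ≤ p → Nonempty (Unique (F.obj (op q))) := fun q hq =>
        h (op q) (U.lower hq hp)
      obtain ⟨_⟩ := h' p le_rfl
      refine ⟨default, fun q f _ => ?_, fun _ _ => Subsingleton.elim _ _⟩
      obtain ⟨_⟩ := h' q (leOfHom f)
      exact Subsingleton.elim _ _

/-- The lower set of the elements at which a presheaf is inhabited. -/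
def presheafSupport (U : Pᵒᵖ ⥤ Type u) : LowerSet P where
  carrier := {p | Nonempty (U.obj (op p))}
  lower' := by
    rintro p q hqp ⟨a⟩
    exact ⟨U.map (homOfLE hqp).op a⟩

/-- The subterminal presheaf supported on a lower set. -/
def LowerSet.indicatorPresheaf (U : LowerSet P) : Pᵒᵖ ⥤ Type u where
  obj c := ULift (PLift (c.unop ∈ U))
  map f := ↾fun h => ⟨⟨U.lower (leOfHom f.unop) h.down.down⟩⟩

/-- A topology is determined by its sheaves, and both sides ask a presheaf to be a singleton on a
lower set, namely the support of the subterminal object. -/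
theorem isClosedSubtopos_iff (J : GrothendieckTopology P) :
    IsClosedSubtopos J ↔ ∃ U : LowerSet P, closedTopology U = J := by
  constructor
  · rintro ⟨U, -, hU⟩
    refine ⟨presheafSupport U, topology_eq_iff_same_sheaves.2 fun F => ?_⟩
    rw [← isSheaf_iff_isSheaf_of_type, ← isSheaf_iff_isSheaf_of_type, hU,
      isIso_prod_snd_iff, isSheaf_closedTopology_iff]
    rfl
  · rintro ⟨U, rfl⟩
    refine ⟨U.indicatorPresheaf, ⟨fun f g _ => ?_⟩, fun F => ?_⟩
    · ext c a
      exact Subsingleton.elim (α := ULift (PLift (c.unop ∈ U))) _ _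
    · rw [isIso_prod_snd_iff, isSheaf_closedTopology_iff]
      exact forall_congr' fun c => ⟨fun h ⟨⟨⟨hc⟩⟩⟩ => h hc, fun h hc => h ⟨⟨⟨hc⟩⟩⟩⟩

theorem mk_isClosedSubtopos :
    #{J : GrothendieckTopology P // IsClosedSubtopos J} = #(LowerSet P) := by
  simp_rw [isClosedSubtopos_iff]
  exact mk_range_eq _ closedTopology_injective

end ClosedSubtopos

theorem mk_lowerSet_finSubsetsRev (I : Type u) [Infinite I] :
    #(LowerSet (FinSubsetsRev I)) = (2 : Cardinal.{u}) ^ #(FinSubsetsRev I) := by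
  apply le_antisymm
  · rw [← mk_set]
    exact mk_le_of_injective SetLike.coe_injective
  · rw [mk_finSubsetsRev, ← mk_set]
    -- The finite sets meeting `A` form a lower set, and its singletons recover `A`.
    refine mk_le_of_injective (f := fun A : Set I =>
      (⟨{p | ∃ i ∈ OrderDual.ofDual p, i ∈ A}, fun p q hqp ⟨i, hi, hA⟩ => ⟨i, hqp hi, hA⟩⟩ :
        LowerSet (FinSubsetsRev I))) fun A B h => ?_
    ext i
    have h' : (∃ j ∈ ({i} : Finset I), j ∈ A) ↔ ∃ j ∈ ({i} : Finset I), j ∈ B :=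
      iff_of_eq (congrArg (fun U : LowerSet (FinSubsetsRev I) => OrderDual.toDual {i} ∈ U) h)
    simpa using h'

/-! ### Dense subpresheaves and local finite generation. -/

section DenseSubfunctor

open Opposite

variable {C : Type u} [SmallCategory C] {J : GrothendieckTopology C} {X Y : Cᵒᵖ ⥤ Type u}

variable (J) in
/-- A subpresheaf `G` of `X` is dense if every section of `X` locally belongs to `G`. -/
def CategoryTheory.Subfunctor.IsDense (G : Subfunctor X) : Prop :=
  ∀ ⦃c : Cᵒᵖ⦄ (a : X.obj c), G.sieveOfSection a ∈ J c.unop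

theorem CategoryTheory.Subfunctor.pullback_sieveOfSection (G : Subfunctor X) {c d : C}
    (f : d ⟶ c) (a : X.obj (op c)) :
    (G.sieveOfSection a).pullback f = G.sieveOfSection (X.map f.op a) := by
  ext e g
  simp [Sieve.pullback_apply]

theorem CategoryTheory.Subfunctor.sieveOfSection_eq_top (G : Subfunctor X) {c : Cᵒᵖ}
    {a : X.obj c} (ha : a ∈ G.obj c) : G.sieveOfSection a = ⊤ := by
  ext d g
  simpa using G.map g.op ha

theorem CategoryTheory.Subfunctor.IsDense.trans {G H : Subfunctor X} (hG : G.IsDense J)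
    (h : ∀ ⦃c : Cᵒᵖ⦄ (a : X.obj c), a ∈ G.obj c → H.sieveOfSection a ∈ J c.unop) :
    H.IsDense J := by
  intro c a
  refine J.transitive (hG a) _ fun d f hf => ?_
  rw [Subfunctor.pullback_sieveOfSection]
  exact h _ hf

theorem CategoryTheory.Subfunctor.IsDense.mono {G H : Subfunctor X} (hG : G.IsDense J)
    (h : G ≤ H) : H.IsDense J :=
  hG.trans fun c a ha => by
    rw [H.sieveOfSection_eq_top (h c ha)]
    exact J.top_mem _

/-- A subpresheaf is dense precisely when it detects equality of morphisms to sheaves. -/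
theorem CategoryTheory.Subfunctor.isDense_iff_forall_isSheaf (G : Subfunctor X) :
    G.IsDense J ↔ ∀ ⦃Z : Cᵒᵖ ⥤ Type u⦄, Presheaf.IsSheaf J Z → ∀ g h : X ⟶ Z,
      (∀ c, ∀ a ∈ G.obj c, g.app c a = h.app c a) → g = h := by
  constructor
  · intro hG Z hZ g h hgh
    rw [isSheaf_iff_isSheaf_of_type] at hZ
    ext c a
    refine (hZ _ (hG a)).isSeparatedFor.ext fun d f hf => ?_
    change Z.map f.op (g.app c a) = Z.map f.op (h.app c a)
    rw [← NatTrans.naturality_apply, ← NatTrans.naturality_apply]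
    exact hgh _ _ hf
  · intro H c a
    -- The test sheaf is the sheaf of closed sieves: the classifying map of the closure of `G`
    -- agrees on `G` with the constant map `⊤`, and their equality everywhere is density.
    have hZ : Presheaf.IsSheaf J (Functor.closedSieves J).toFunctor :=
      (isSheaf_iff_isSheaf_of_type J _).2 (classifier_isSheaf J)
    let g : X ⟶ (Functor.closedSieves J).toFunctor :=
      { app c := ↾fun a => ⟨J.close (G.sieveOfSection a), J.close_isClosed _⟩
        naturality c d f := by
          ext a
          apply Subtype.ext
          change J.close (G.sieveOfSection (X.map f a)) =
            (J.close (G.sieveOfSection a)).pullback f.unop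
          rw [← J.pullback_close, Subfunctor.pullback_sieveOfSection]
          rfl }
    let h : X ⟶ (Functor.closedSieves J).toFunctor :=
      { app c := ↾fun _ => ⟨(⊤ : Sieve c.unop), fun _ _ _ => trivial⟩
        naturality c d f := by
          ext a
          rfl }
    have hgh : g = h := H hZ g h fun c a ha => by
      apply Subtype.ext
      change J.close (G.sieveOfSection a) = ⊤
      rw [G.sieveOfSection_eq_top ha, J.close_eq_top_iff_mem]
      exact J.top_mem _
    rw [← J.close_eq_top_iff_mem]
    exact congrArg Subtype.val (ConcreteCategory.congr_hom (NatTrans.congr_app hgh c) a)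

/-- The union of the images of a family of morphisms of presheaves. -/
def familyImage {ι : Type*} {Y : ι → Cᵒᵖ ⥤ Type u} (f : ∀ i, Y i ⟶ X) : Subfunctor X where
  obj c := {a | ∃ (i : ι) (y : (Y i).obj c), (f i).app c y = a}
  map := by
    rintro c d k _ ⟨i, y, rfl⟩
    exact ⟨i, (Y i).map k y, NatTrans.naturality_apply _ _ _⟩

/-- The subpresheaf generated by a set of sections. -/
def generatedSubfunctor (T : Set (Σ c : C, X.obj (op c))) : Subfunctor X where
  obj c := {a | ∃ t ∈ T, ∃ k : c.unop ⟶ t.1, X.map k.op t.2 = a}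
  map := by
    rintro c d f _ ⟨t, ht, k, rfl⟩
    exact ⟨t, ht, f.unop ≫ k, by simp⟩

variable (J X) in
/-- A presheaf is locally finitely generated if a finite set of sections generates a dense
subpresheaf. -/
def IsLocallyFinitelyGenerated : Prop :=
  ∃ T : Set (Σ c : C, X.obj (op c)), T.Finite ∧ (generatedSubfunctor T).IsDense J

theorem isDense_familyImage_iff {ι : Type*} {Y : ι → Cᵒᵖ ⥤ Type u} (f : ∀ i, Y i ⟶ X) :
    (familyImage f).IsDense J ↔ ∀ ⦃Z : Cᵒᵖ ⥤ Type u⦄, Presheaf.IsSheaf J Z → ∀ g h : X ⟶ Z,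
      (∀ i, f i ≫ g = f i ≫ h) → g = h := by
  rw [Subfunctor.isDense_iff_forall_isSheaf]
  refine forall₂_congr fun Z _ => forall₂_congr fun g h => imp_congr_left ?_
  constructor
  · intro H i
    ext c y
    exact H c _ ⟨i, y, rfl⟩
  · rintro H c _ ⟨i, y, rfl⟩
    exact ConcreteCategory.congr_hom (NatTrans.congr_app (H i) c) y

theorem IsLocallyFinitelyGenerated.of_isDense_range (hX : IsLocallyFinitelyGenerated J X)
    (f : X ⟶ Y) (hf : (Subfunctor.range f).IsDense J) : IsLocallyFinitelyGenerated J Y := by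
  obtain ⟨T, hT, hd⟩ := hX
  refine ⟨(fun t => ⟨t.1, f.app _ t.2⟩) '' T, hT.image _, hf.trans ?_⟩
  rintro c _ ⟨a, rfl⟩
  refine J.superset_covering ?_ (hd a)
  rintro d g ⟨t, ht, k, hk⟩
  refine ⟨_, ⟨t, ht, rfl⟩, k, ?_⟩
  change Y.map k.op (f.app _ t.2) = Y.map g.op (f.app _ a)
  rw [← NatTrans.naturality_apply, ← NatTrans.naturality_apply, hk]

theorem isLocallyFinitelyGenerated_yoneda (c : C) :
    IsLocallyFinitelyGenerated J (yoneda.obj c) := by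
  refine ⟨{⟨c, 𝟙 c⟩}, Set.finite_singleton _, fun d a => ?_⟩
  rw [Subfunctor.sieveOfSection_eq_top]
  · exact J.top_mem _
  · exact ⟨_, rfl, a, by simp⟩

end DenseSubfunctor

/-! ### Epimorphic families and compactness, uniformly for presheaves and sheaves. -/

section SheafModel

open Opposite

variable {C : Type u} [SmallCategory C] (J : GrothendieckTopology C)
  {E : Type w} [Category.{u} E]

/-- The fully faithful functor `U` identifies `E` with the category of
sheaves for `J`. -/
structure IsSheafModel (U : E ⥤ Cᵒᵖ ⥤ Type u) : Prop where
  full : U.Full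
  faithful : U.Faithful
  isSheaf_iff : ∀ Z, Presheaf.IsSheaf J Z ↔ U.essImage Z

theorem isSheafModel_sheafToPresheaf : IsSheafModel J (sheafToPresheaf J (Type u)) where
  full := inferInstance
  faithful := inferInstance
  isSheaf_iff Z := ⟨fun hZ => ⟨⟨Z, hZ⟩, ⟨Iso.refl _⟩⟩, fun ⟨F, ⟨e⟩⟩ =>
    Presheaf.isSheaf_of_iso_iff e |>.1 F.property⟩

theorem isSheafModel_id : IsSheafModel (⊥ : GrothendieckTopology C) (𝟭 (Cᵒᵖ ⥤ Type u)) where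
  full := inferInstance
  faithful := inferInstance
  isSheaf_iff Z := ⟨fun _ => ⟨Z, ⟨Iso.refl _⟩⟩, fun _ => Presheaf.isSheaf_bot Z⟩

namespace IsSheafModel

variable {J} {U : E ⥤ Cᵒᵖ ⥤ Type u} (hU : IsSheafModel J U)

include hU

theorem isDense_familyImage_iff {X : Cᵒᵖ ⥤ Type u} {ι : Type*} {Y : ι → Cᵒᵖ ⥤ Type u}
    (f : ∀ i, Y i ⟶ X) :
    (familyImage f).IsDense J ↔ ∀ ⦃Z : E⦄ (g h : X ⟶ U.obj Z),
      (∀ i, f i ≫ g = f i ≫ h) → g = h := by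
  rw [_root_.isDense_familyImage_iff]
  constructor
  · exact fun H Z g h hgh => H ((hU.isSheaf_iff _).2 (U.obj_mem_essImage Z)) g h hgh
  · intro H Z hZ g h hgh
    obtain ⟨Z', ⟨e⟩⟩ := (hU.isSheaf_iff _).1 hZ
    rw [← cancel_mono e.inv]
    exact H _ _ fun i => by rw [reassoc_of% hgh i]

theorem epimorphicFamily_iff {X : E} {ι : Type*} {Y : ι → E} (f : ∀ i, Y i ⟶ X) :
    EpimorphicFamily f ↔ (familyImage fun i => U.map (f i)).IsDense J := by
  have := hU.full
  have := hU.faithful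
  rw [hU.isDense_familyImage_iff]
  constructor
  · intro H Z g h hgh
    obtain ⟨g, rfl⟩ := U.map_surjective g
    obtain ⟨h, rfl⟩ := U.map_surjective h
    exact congrArg _ (H g h fun i => U.map_injective (by simpa using hgh i))
  · intro H Z g h hgh
    exact U.map_injective (H _ _ fun i => by rw [← U.map_comp, hgh, U.map_comp])

variable {L : (Cᵒᵖ ⥤ Type u) ⥤ E} (adj : L ⊣ U)

include adj

theorem epimorphicFamily_map_iff {X : Cᵒᵖ ⥤ Type u} {ι : Type*} {Y : ι → Cᵒᵖ ⥤ Type u}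
    (f : ∀ i, Y i ⟶ X) :
    EpimorphicFamily (fun i => L.map (f i)) ↔ (familyImage f).IsDense J := by
  rw [hU.isDense_familyImage_iff]
  constructor
  · intro H Z g h hgh
    refine (adj.homEquiv _ _).symm.injective (H _ _ fun i => ?_)
    rw [← adj.homEquiv_naturality_left_symm, hgh, adj.homEquiv_naturality_left_symm]
  · intro H Z g h hgh
    refine (adj.homEquiv _ _).injective (H _ _ fun i => ?_)
    rw [← adj.homEquiv_naturality_left, hgh, adj.homEquiv_naturality_left]

theorem isDense_range_unit (X : Cᵒᵖ ⥤ Type u) :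
    (Subfunctor.range (adj.unit.app X)).IsDense J := by
  have h : (familyImage fun _ : Unit => adj.unit.app X).IsDense J := by
    rw [hU.isDense_familyImage_iff]
    intro Z g h hgh
    have := hU.full
    obtain ⟨g, rfl⟩ := U.map_surjective g
    obtain ⟨h, rfl⟩ := U.map_surjective h
    refine congrArg _ ((adj.homEquiv _ _).injective ?_)
    simpa [Adjunction.homEquiv_unit] using hgh ()
  refine h.mono ?_
  rintro c _ ⟨_, y, rfl⟩
  exact ⟨y, rfl⟩

/-- All sections of `U.obj X` together give an epimorphic family from reflected representables; a
finite epimorphic subfamily gives the generators. -/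
theorem isLocallyFinitelyGenerated_of_isCompactObject {X : E} (hX : IsCompactObject X) :
    IsLocallyFinitelyGenerated J (U.obj X) := by
  let f (t : Σ c : C, (U.obj X).obj (op c)) : L.obj (yoneda.obj t.1) ⟶ X :=
    (adj.homEquiv _ _).symm (yonedaEquiv.symm t.2)
  have hf : ∀ t, yonedaEquiv.symm t.2 = adj.unit.app _ ≫ U.map (f t) := fun t =>
    ((adj.homEquiv _ _).apply_symm_apply _).symm.trans (adj.homEquiv_unit _ _ _)
  obtain ⟨s, hs⟩ := hX _ f (by
    have := hU.faithful
    intro Z g h hgh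
    refine U.map_injective ?_
    ext ⟨c⟩ a
    have h1 : yonedaEquiv.symm a ≫ U.map g = yonedaEquiv.symm a ≫ U.map h := by
      have := hf ⟨c, a⟩
      dsimp only at this
      rw [this, Category.assoc, Category.assoc, ← U.map_comp, ← U.map_comp, hgh]
    have h2 := congrArg yonedaEquiv h1
    simp only [yonedaEquiv_comp, Equiv.apply_symm_apply] at h2
    exact h2)
  refine ⟨s, s.finite_toSet, ?_⟩
  have hd : (familyImage fun t : s => yonedaEquiv.symm t.1.2).IsDense J := by
    rw [hU.isDense_familyImage_iff]
    have := hU.full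
    intro Z g h hgh
    obtain ⟨g, rfl⟩ := U.map_surjective g
    obtain ⟨h, rfl⟩ := U.map_surjective h
    refine congrArg _ (hs _ _ fun t => (adj.homEquiv _ _).injective ?_)
    have := hgh t
    rw [hf t.1] at this
    simpa [Adjunction.homEquiv_unit] using this
  refine hd.mono ?_
  rintro c _ ⟨t, k, rfl⟩
  exact ⟨t.1, t.2, k, (yonedaEquiv_symm_app_apply _ _ _).symm⟩

end IsSheafModel

end SheafModel

/-! ### Topologies of finite type. -/

section FiniteType

open Opposite

variable {P : Type u} [Preorder P]

/-- The sieve on `p` generated by the lower bounds of `p` and an element of `s`. -/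
def belowSieve (s : Set P) (p : P) : Sieve p where
  arrows q _ := ∃ r ∈ s, q ≤ r
  downward_closed := by
    rintro q q' _ ⟨r, hr, hq⟩ f
    exact ⟨r, hr, (leOfHom f).trans hq⟩

/-- A Grothendieck topology on a preorder is of finite type if every covering sieve contains a
finitely generated covering sieve. -/
def IsFiniteTypeTopology (J : GrothendieckTopology P) : Prop :=
  ∀ ⦃p : P⦄ (R : Sieve p), R ∈ J p →
    ∃ s : Set P, s.Finite ∧ (∀ r ∈ s, ∃ f : r ⟶ p, R f) ∧ belowSieve s p ∈ J p

theorem isFiniteTypeTopology_bot : IsFiniteTypeTopology (⊥ : GrothendieckTopology P) := by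
  intro p R hR
  rw [GrothendieckTopology.bot_covering] at hR
  subst hR
  refine ⟨{p}, Set.finite_singleton _, fun r hr => ⟨eqToHom hr, trivial⟩, ?_⟩
  rw [GrothendieckTopology.bot_covering]
  ext q f
  exact iff_of_true ⟨p, rfl, leOfHom f⟩ trivial

theorem isFiniteTypeTopology_closedTopology (U : LowerSet P) :
    IsFiniteTypeTopology (closedTopology U) := by
  rintro p R (rfl | hp)
  · refine ⟨{p}, Set.finite_singleton _, fun r hr => ⟨eqToHom hr, trivial⟩, Or.inl ?_⟩
    ext q f
    exact iff_of_true ⟨p, rfl, leOfHom f⟩ trivial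
  · exact ⟨∅, Set.finite_empty, by simp, Or.inr hp⟩

theorem mk_isFiniteTypeTopology_le [Infinite P] :
    #{J : GrothendieckTopology P // IsFiniteTypeTopology J} ≤ 2 ^ #P := by
  have hP : #(Finset P × P) = #P := by
    rw [mk_prod, lift_id, lift_id, mk_finset_of_infinite, mul_eq_self (aleph0_le_mk P)]
  rw [← hP, ← mk_set]
  refine mk_le_of_injective (f := fun J : {J : GrothendieckTopology P // IsFiniteTypeTopology J} =>
    {t : Finset P × P | belowSieve (t.1 : Set P) t.2 ∈ J.1 t.2}) fun J K h => ?_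
  have key : ∀ J : {J : GrothendieckTopology P // IsFiniteTypeTopology J},
      ∀ (p : P) (R : Sieve p), R ∈ J.1 p ↔ ∃ s : Finset P, (∀ r ∈ s, ∃ f : r ⟶ p, R f) ∧
        belowSieve (s : Set P) p ∈ J.1 p := by
    refine fun J p R => ⟨fun hR => ?_, fun ⟨s, hs, hsJ⟩ => J.1.superset_covering ?_ hsJ⟩
    · obtain ⟨s, hs, hsR, hsJ⟩ := J.2 R hR
      lift s to Finset P using hs
      exact ⟨s, hsR, hsJ⟩
    · rintro q f ⟨r, hr, hqr⟩
      obtain ⟨g, hg⟩ := hs r hr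
      exact R.downward_closed hg (homOfLE hqr)
  refine Subtype.ext ?_
  ext p R
  rw [key J, key K]
  exact exists_congr fun s => and_congr_right fun _ => Set.ext_iff.1 h (s, p)

variable {J : GrothendieckTopology P} {X Y Z Q : Pᵒᵖ ⥤ Type u}

/-- Each of the finitely many generators lies in `G` on a cover, which may be taken finitely
generated; the restrictions to those finitely many elements are the new generators. -/
theorem IsFiniteTypeTopology.exists_finite_isDense (hJ : IsFiniteTypeTopology J)
    (hX : IsLocallyFinitelyGenerated J X) {G : Subfunctor X} (hG : G.IsDense J) :
    ∃ T : Set (Σ p : P, X.obj (op p)), T.Finite ∧ (∀ t ∈ T, t.2 ∈ G.obj (op t.1)) ∧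
      (generatedSubfunctor T).IsDense J := by
  obtain ⟨T, hT, hd⟩ := hX
  have h : ∀ t : Σ p : P, X.obj (op p), ∃ S : Set (Σ p : P, X.obj (op p)), S.Finite ∧
      (∀ e ∈ S, e.2 ∈ G.obj (op e.1)) ∧
      (generatedSubfunctor S).sieveOfSection t.2 ∈ J t.1 := by
    intro t
    obtain ⟨s, hs, hsG, hsJ⟩ := hJ _ (hG t.2)
    choose f hf using hsG
    have := hs.to_subtype
    refine ⟨Set.range fun r : s => ⟨r.1, X.map (f r.1 r.2).op t.2⟩, Set.finite_range _, ?_, ?_⟩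
    · rintro _ ⟨r, rfl⟩
      exact hf r.1 r.2
    · refine J.superset_covering ?_ hsJ
      rintro q g ⟨r, hr, hqr⟩
      refine ⟨_, ⟨⟨r, hr⟩, rfl⟩, homOfLE hqr, ?_⟩
      rw [← Functor.map_comp_apply, ← op_comp]
      rfl
  choose S hS hSG hSJ using h
  refine ⟨⋃ t ∈ T, S t, hT.biUnion fun t _ => hS t, ?_, hd.trans ?_⟩
  · intro e he
    obtain ⟨t, _, he⟩ := Set.mem_iUnion₂.1 he
    exact hSG t e he
  · rintro c _ ⟨t, ht, k, rfl⟩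
    rw [← Subfunctor.pullback_sieveOfSection]
    refine J.pullback_stable _ (J.superset_covering ?_ (hSJ t))
    rintro q g ⟨e, he, l, hl⟩
    exact ⟨e, Set.mem_biUnion ht he, l, hl⟩

theorem IsFiniteTypeTopology.exists_finset_isDense (hJ : IsFiniteTypeTopology J)
    (hX : IsLocallyFinitelyGenerated J X) {ι : Type*} {Y : ι → Pᵒᵖ ⥤ Type u} (f : ∀ i, Y i ⟶ X)
    (hf : (familyImage f).IsDense J) :
    ∃ s : Finset ι, (familyImage fun i : s => f i).IsDense J := by
  classical
  obtain ⟨T, hT, hTf, hd⟩ := hJ.exists_finite_isDense hX hf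
  choose i hi using hTf
  have := hT.fintype
  refine ⟨Finset.univ.image fun t : T => i t.1 t.2, hd.mono ?_⟩
  rintro c _ ⟨t, ht, k, rfl⟩
  refine (familyImage _).map k.op ?_
  obtain ⟨y, hy⟩ := hi t ht
  exact ⟨⟨i t ht, Finset.mem_image.2 ⟨⟨t, ht⟩, Finset.mem_univ _, rfl⟩⟩, y, hy⟩

/-- A criterion for a subpresheaf of the product of two locally finitely generated presheaves to be
locally finitely generated. -/
theorem isLocallyFinitelyGenerated_of_forall_generators (a : Q ⟶ Y) (b : Q ⟶ Z)
    (hab : ∀ ⦃c⦄ (x x' : Q.obj c), a.app c x = a.app c x' → b.app c x = b.app c x' → x = x')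
    {S : Set (Σ p : P, Y.obj (op p))} (hS : S.Finite) (hSd : (generatedSubfunctor S).IsDense J)
    {T : Set (Σ p : P, Z.obj (op p))} (hT : T.Finite) (hTd : (generatedSubfunctor T).IsDense J)
    (h : ∀ y ∈ S, ∀ z ∈ T, ∃ W : Set P, W.Finite ∧
      (∀ r ∈ W, ∃ (k : r ⟶ y.1) (l : r ⟶ z.1) (x : Q.obj (op r)),
        a.app _ x = Y.map k.op y.2 ∧ b.app _ x = Z.map l.op z.2) ∧
      ∀ (p : P) (x : Q.obj (op p)) (k : p ⟶ y.1) (l : p ⟶ z.1),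
        a.app _ x = Y.map k.op y.2 → b.app _ x = Z.map l.op z.2 → belowSieve W p ∈ J p) :
    IsLocallyFinitelyGenerated J Q := by
  choose! W hW hWe hWc using h
  let V (y : Σ p : P, Y.obj (op p)) (z : Σ p : P, Z.obj (op p)) : Set (Σ p : P, Q.obj (op p)) :=
    {e | e.1 ∈ W y z ∧ ∃ (k : e.1 ⟶ y.1) (l : e.1 ⟶ z.1),
        a.app _ e.2 = Y.map k.op y.2 ∧ b.app _ e.2 = Z.map l.op z.2}
  -- Morphisms in `P` are unique and `a`, `b` are jointly injective, so an element of `V y z` is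
  -- determined by its stage in the finite set `W y z`.
  have hV : ∀ y ∈ S, ∀ z ∈ T, (V y z).Finite := by
    intro y hy z hz
    refine Set.Finite.of_injOn (f := Sigma.fst) (fun e he => he.1) ?_ (hW y hy z hz)
    rintro ⟨p, x⟩ ⟨-, k, l, hk, hl⟩ ⟨q, x'⟩ ⟨-, k', l', hk', hl'⟩ (rfl : p = q)
    obtain rfl : k = k' := Subsingleton.elim _ _
    obtain rfl : l = l' := Subsingleton.elim _ _
    rw [hab x x' (hk.trans hk'.symm) (hl.trans hl'.symm)]
  refine ⟨⋃ y ∈ S, ⋃ z ∈ T, V y z, hS.biUnion fun y hy => hT.biUnion fun z hz => hV y hy z hz,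
    fun c x => ?_⟩
  refine J.transitive (J.intersection_covering (hSd (a.app c x)) (hTd (b.app c x))) _ ?_
  rintro p f ⟨⟨y, hy, k, hk⟩, ⟨z, hz, l, hl⟩⟩
  rw [Subfunctor.pullback_sieveOfSection]
  rw [← NatTrans.naturality_apply] at hk hl
  refine J.superset_covering ?_ (hWc y hy z hz p _ k l hk.symm hl.symm)
  rintro q g ⟨r, hr, hqr⟩
  obtain ⟨k', l', x', hk', hl'⟩ := hWe y hy z hz r hr
  refine ⟨⟨r, x'⟩, Set.mem_biUnion hy (Set.mem_biUnion hz ⟨hr, k', l', hk', hl'⟩),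
    homOfLE hqr, ?_⟩
  apply hab
  · rw [NatTrans.naturality_apply, hk', NatTrans.naturality_apply, ← hk,
      ← Functor.map_comp_apply, ← Functor.map_comp_apply]
    rfl
  · rw [NatTrans.naturality_apply, hl', NatTrans.naturality_apply, ← hl,
      ← Functor.map_comp_apply, ← Functor.map_comp_apply]
    rfl

end FiniteType

/-! ### Coherent subtoposes are those of finite type. -/

section CoherentSubtopos

open Opposite

variable {P : Type u}

section Preorder

variable [Preorder P] {J : GrothendieckTopology P} {E : Type w} [Category.{u} E]
  {U : E ⥤ Pᵒᵖ ⥤ Type u} {L : (Pᵒᵖ ⥤ Type u) ⥤ E}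

theorem IsSheafModel.isCompactObject_iff (hU : IsSheafModel J U) (adj : L ⊣ U)
    (hJ : IsFiniteTypeTopology J) (X : E) :
    IsCompactObject X ↔ IsLocallyFinitelyGenerated J (U.obj X) := by
  refine ⟨hU.isLocallyFinitelyGenerated_of_isCompactObject adj, fun hX ι Y f hf => ?_⟩
  rw [hU.epimorphicFamily_iff] at hf
  obtain ⟨s, hs⟩ := hJ.exists_finset_isDense hX _ hf
  exact ⟨s, (hU.epimorphicFamily_iff _).2 hs⟩

theorem IsSheafModel.isCompactObject_map (hU : IsSheafModel J U) (adj : L ⊣ U)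
    (hJ : IsFiniteTypeTopology J) {F : Pᵒᵖ ⥤ Type u} (hF : IsLocallyFinitelyGenerated J F) :
    IsCompactObject (L.obj F) :=
  (hU.isCompactObject_iff adj hJ _).2
    (hF.of_isDense_range _ (hU.isDense_range_unit adj F))

theorem isCompactObject_presheaf_iff (F : Pᵒᵖ ⥤ Type u) :
    IsCompactObject F ↔ IsLocallyFinitelyGenerated ⊥ F :=
  isSheafModel_id.isCompactObject_iff Adjunction.id isFiniteTypeTopology_bot F

theorem IsLocallyFinitelyGenerated.of_bot {F : Pᵒᵖ ⥤ Type u}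
    (hF : IsLocallyFinitelyGenerated ⊥ F) (J : GrothendieckTopology P) :
    IsLocallyFinitelyGenerated J F := by
  obtain ⟨T, hT, hd⟩ := hF
  exact ⟨T, hT, fun c a => (bot_le : ⊥ ≤ J) _ (hd a)⟩

/-- Pullbacks of representables over a coherent presheaf are covered by finitely many
representables. -/
theorem IsCoherentObject.exists_finite_lowerBounds {F : Pᵒᵖ ⥤ Type u} (hF : IsCoherentObject F)
    {p q : P} (a : F.obj (op p)) (b : F.obj (op q)) :
    ∃ W : Set P, W.Finite ∧
      (∀ r ∈ W, ∃ (k : r ⟶ p) (l : r ⟶ q), F.map k.op a = F.map l.op b) ∧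
      ∀ (r : P) (k : r ⟶ p) (l : r ⟶ q), F.map k.op a = F.map l.op b → ∃ t ∈ W, r ≤ t := by
  have hsq := IsPullback.of_hasPullback (yonedaEquiv.symm a) (yonedaEquiv.symm b)
  have hc := hF.2 _ _ _ _ hsq
    ((isCompactObject_presheaf_iff _).2 (isLocallyFinitelyGenerated_yoneda p))
    ((isCompactObject_presheaf_iff _).2 (isLocallyFinitelyGenerated_yoneda q))
  obtain ⟨T, hT, hd⟩ := (isCompactObject_presheaf_iff _).1 hc
  have hev : ∀ r : P, _ := fun r => hsq.map ((evaluation _ _).obj (op r))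
  refine ⟨Sigma.fst '' T, hT.image _, ?_, fun r k l hkl => ?_⟩
  · rintro _ ⟨⟨r, x⟩, -, rfl⟩
    refine ⟨(pullback.fst (yonedaEquiv.symm a) (yonedaEquiv.symm b)).app _ x,
      (pullback.snd (yonedaEquiv.symm a) (yonedaEquiv.symm b)).app _ x, ?_⟩
    exact ConcreteCategory.congr_hom (hev r).w x
  · obtain ⟨x, -, -⟩ := Types.exists_of_isPullback (hev r) k l hkl
    have hx := hd x
    rw [GrothendieckTopology.bot_covering] at hx
    have hx' : (generatedSubfunctor T).sieveOfSection x (𝟙 r) := hx ▸ trivial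
    obtain ⟨t, ht, m, -⟩ := hx'
    exact ⟨t.1, ⟨t, ht, rfl⟩, leOfHom m⟩

/-- Generators of the two compact sheaves can be chosen to map to sections coming from `F`.
Coherence of `F` then bounds the places where two such sections agree by finitely many elements, and
these generate the pullback locally. -/
theorem isCoherentObject_presheafToSheaf {J : GrothendieckTopology P}
    (hJ : IsFiniteTypeTopology J) {F : Pᵒᵖ ⥤ Type u} (hF : IsCoherentObject F) :
    IsCoherentObject ((presheafToSheaf J (Type u)).obj F) := by
  have hU := isSheafModel_sheafToPresheaf J
  have adj := sheafificationAdjunction J (Type u)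
  refine ⟨hU.isCompactObject_map adj hJ (((isCompactObject_presheaf_iff F).1 hF.1).of_bot J),
    fun Q Y Z a b f g hsq hY hZ => ?_⟩
  rw [hU.isCompactObject_iff adj hJ] at hY hZ ⊢
  let η : F ⟶ ((presheafToSheaf J (Type u)).obj F).obj := toSheafify J F
  have hη : (Subfunctor.range η).IsDense J :=
    hU.isDense_range_unit (sheafificationAdjunction J (Type u)) F
  have hdense : ∀ {V : Sheaf J (Type u)} (f : V ⟶ (presheafToSheaf J (Type u)).obj F),
      ((Subfunctor.range η).preimage f.hom).IsDense J := by
    intro V f c x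
    refine J.superset_covering ?_ (hη (f.hom.app c x))
    intro q k hk
    change f.hom.app _ (V.obj.map k.op x) ∈ (Subfunctor.range η).obj _
    rw [NatTrans.naturality_apply]
    exact hk
  obtain ⟨S, hS, hSF, hSd⟩ := hJ.exists_finite_isDense hY (hdense f)
  obtain ⟨T, hT, hTF, hTd⟩ := hJ.exists_finite_isDense hZ (hdense g)
  have hev : ∀ p : P, _ := fun p =>
    (hsq.map (sheafToPresheaf J (Type u))).map ((evaluation _ _).obj (op p))
  refine isLocallyFinitelyGenerated_of_forall_generators a.hom b.hom
    (fun c x x' => Types.ext_of_isPullback (hev c.unop)) hS hSd hT hTd fun y hy z hz => ?_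
  obtain ⟨u, hu⟩ := hSF y hy
  obtain ⟨v, hv⟩ := hTF z hz
  obtain ⟨W, hW, hWe, hWc⟩ := hF.exists_finite_lowerBounds u v
  refine ⟨W, hW, fun r hr => ?_, fun p x k l hk hl => ?_⟩
  · obtain ⟨k, l, hkl⟩ := hWe r hr
    obtain ⟨x, hx, hx'⟩ := Types.exists_of_isPullback (hev r)
      (Y.obj.map k.op y.2) (Z.obj.map l.op z.2) (by
        change f.hom.app _ (Y.obj.map k.op y.2) = g.hom.app _ (Z.obj.map l.op z.2)
        rw [NatTrans.naturality_apply, NatTrans.naturality_apply, ← hu, ← hv]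
        erw [← NatTrans.naturality_apply η, ← NatTrans.naturality_apply η]
        rw [hkl])
    exact ⟨k, l, x, hx, hx'⟩
  -- Sections of `F` that become equal in the sheafification are equal on a cover, and every member
  -- of that cover lies below an element of `W`.
  · have hloc : Presheaf.equalizerSieve (F := F) (X := op p) (F.map k.op u) (F.map l.op v) ∈ J p := by
      refine Presheaf.equalizerSieve_mem J η _ _ ?_
      have hw : f.hom.app _ (a.hom.app _ x) = g.hom.app _ (b.hom.app _ x) :=
        ConcreteCategory.congr_hom (hev p).w x
      rw [hk, hl, NatTrans.naturality_apply, NatTrans.naturality_apply, ← hu, ← hv] at hw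
      erw [NatTrans.naturality_apply η, NatTrans.naturality_apply η]
      exact hw
    refine J.superset_covering ?_ hloc
    intro q m hm
    refine hWc q (m ≫ k) (m ≫ l) ?_
    rw [op_comp, op_comp, Functor.map_comp_apply, Functor.map_comp_apply]
    exact hm

end Preorder

section SemilatticeInf

variable [SemilatticeInf P]

/-- Over a subterminal presheaf every pair of sections is compatible, so a pair of generators
contributes the single stage given by the meet. -/
theorem isCoherentObject_yoneda (p : P) : IsCoherentObject (yoneda.obj p) := by
  refine ⟨(isCompactObject_presheaf_iff _).2 (isLocallyFinitelyGenerated_yoneda p),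
    fun Q Y Z a b f g hsq hY hZ => ?_⟩
  rw [isCompactObject_presheaf_iff] at hY hZ ⊢
  obtain ⟨S, hS, hSd⟩ := hY
  obtain ⟨T, hT, hTd⟩ := hZ
  have hev : ∀ p : P, _ := fun p => hsq.map ((evaluation _ _).obj (op p))
  refine isLocallyFinitelyGenerated_of_forall_generators a b
    (fun c x x' => Types.ext_of_isPullback (hev c.unop)) hS hSd hT hTd fun y hy z hz => ?_
  refine ⟨{y.1 ⊓ z.1}, Set.finite_singleton _, ?_, fun q x k l _ _ => ?_⟩
  · rintro _ rfl
    obtain ⟨x, hx, hx'⟩ := Types.exists_of_isPullback (hev (y.1 ⊓ z.1))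
      (Y.map (homOfLE inf_le_left).op y.2) (Z.map (homOfLE inf_le_right).op z.2)
      (Subsingleton.elim (α := (y.1 ⊓ z.1) ⟶ p) _ _)
    exact ⟨homOfLE inf_le_left, homOfLE inf_le_right, x, hx, hx'⟩
  · rw [GrothendieckTopology.bot_covering]
    ext r m
    exact iff_of_true ⟨_, rfl, (leOfHom m).trans (le_inf (leOfHom k) (leOfHom l))⟩ trivial

/-- A covering sieve becomes an epimorphic family onto the sheafified representable, which is
compact because representables are coherent; a finite subfamily generates a smaller cover. -/
theorem IsCoherentSubtopos.isFiniteTypeTopology {J : GrothendieckTopology P}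
    (h : IsCoherentSubtopos J) : IsFiniteTypeTopology J := by
  intro p R hR
  have hU := isSheafModel_sheafToPresheaf J
  have adj := sheafificationAdjunction J (Type u)
  have hc : IsCompactObject ((presheafToSheaf J (Type u)).obj (yoneda.obj p)) :=
    (h.2.2 _ (isCoherentObject_yoneda p)).1
  let f (q : {q : P // ∃ f : q ⟶ p, R f}) : yoneda.obj q.1 ⟶ yoneda.obj p :=
    yoneda.map q.2.choose
  obtain ⟨s, hs⟩ := hc _ (fun q => (presheafToSheaf J (Type u)).map (f q)) (by
    rw [hU.epimorphicFamily_map_iff adj]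
    intro c a
    refine J.superset_covering ?_ (J.pullback_stable a hR)
    intro q k hk
    exact ⟨⟨q, _, hk⟩, 𝟙 q, Subsingleton.elim (α := q ⟶ p) _ _⟩)
  refine ⟨Subtype.val '' (s : Set {q : P // ∃ f : q ⟶ p, R f}), s.finite_toSet.image _, ?_, ?_⟩
  · rintro _ ⟨q, -, rfl⟩
    exact q.2
  · have hd := (hU.epimorphicFamily_map_iff adj fun q : s => f q).1 hs
    refine J.superset_covering ?_ (hd (𝟙 p : (yoneda.obj p).obj (op p)))
    rintro q k ⟨i, m, -⟩
    exact ⟨i.1.1, ⟨i.1, i.2, rfl⟩, leOfHom m⟩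

variable [OrderTop P] {E : Type w} [Category.{u} E]

/-- The compact generators are the reflected representables. They are subterminal, so a finite limit
of them is the image of the meet of their indices, with `⊤` for the empty diagram. -/
theorem IsSheafModel.isCoherentTopos {J : GrothendieckTopology P} {U : E ⥤ Pᵒᵖ ⥤ Type u}
    {L : (Pᵒᵖ ⥤ Type u) ⥤ E} (hU : IsSheafModel J U) (adj : L ⊣ U)
    (hJ : IsFiniteTypeTopology J) [PreservesFiniteLimits L] : IsCoherentTopos E := by
  let G : P ⥤ E := yoneda ⋙ L
  have hsub : ∀ (q : P) {Z : E} (f g : Z ⟶ G.obj q), f = g := by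
    intro q Z f g
    -- In a preorder `q` is its own square, and `G` preserves this product, so any two maps into
    -- `G.obj q` coincide.
    have hlim : IsLimit (BinaryFan.mk (𝟙 q) (𝟙 q)) :=
      BinaryFan.isLimitMk (fun s => s.fst) (fun _ => Subsingleton.elim _ _)
        (fun _ => Subsingleton.elim _ _) (fun _ _ _ _ => Subsingleton.elim _ _)
    have hlim' := mapIsLimitOfPreservesOfIsLimit G _ _ hlim
    obtain ⟨l, hl, hl'⟩ := BinaryFan.IsLimit.lift' hlim' f g
    rw [← hl, ← hl']
    rfl
  have hinf : ∀ {D : Type} [Fintype D] (p : D → P) {Z : E} (_ : ∀ d, Z ⟶ G.obj (p d)),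
      Nonempty (Z ⟶ G.obj (Finset.univ.inf p)) := by
    intro D _ p Z f
    have hlim : IsLimit (Fan.mk (Finset.univ.inf p)
        fun d => homOfLE (Finset.inf_le (Finset.mem_univ d))) :=
      Fan.IsLimit.mk _ (fun s => homOfLE (Finset.le_inf fun d _ => leOfHom (s.proj d)))
        (fun _ _ => Subsingleton.elim _ _) (fun _ _ _ => Subsingleton.elim _ _)
    have hlim' := isLimitFanMkObjOfIsLimit G _ _ hlim
    exact ⟨Fan.IsLimit.lift hlim' f⟩
  refine ⟨fun X => ∃ p, Nonempty (X ≅ G.obj p), ?_, ?_, ?_⟩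
  · rintro X ⟨p, ⟨e⟩⟩
    have hX := hU.isCompactObject_map adj hJ (isLocallyFinitelyGenerated_yoneda p)
    intro ι Y f hf
    obtain ⟨s, hs⟩ := hX Y (fun i => f i ≫ e.hom) (fun Z g h hgh =>
      (cancel_epi e.hom).1 (hf _ _ fun i => by simpa using hgh i))
    exact ⟨s, fun Z g h hgh =>
      (cancel_epi e.inv).1 (hs _ _ fun i => by simpa using hgh i)⟩
  · intro X Y f g h
    have := hU.faithful
    refine U.map_injective ?_
    ext ⟨c⟩ a
    have h1 := congrArg (adj.homEquiv _ _)
      (h _ ⟨c, ⟨Iso.refl _⟩⟩ ((adj.homEquiv _ _).symm (yonedaEquiv.symm a)))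
    rw [adj.homEquiv_naturality_right, adj.homEquiv_naturality_right,
      Equiv.apply_symm_apply] at h1
    have h2 := congrArg yonedaEquiv h1
    simp only [yonedaEquiv_comp, Equiv.apply_symm_apply] at h2
    exact h2
  · intro D _ _
    refine ⟨?_⟩
    rintro X ⟨pres⟩
    choose p e using pres.prop_diag_obj
    let e d := (e d).some
    have hsub' : ∀ (d : D) {Z : E} (f g : Z ⟶ pres.diag.obj d), f = g := fun d Z f g => by
      rw [← cancel_mono (e d).hom]
      exact hsub _ _ _
    obtain ⟨φ⟩ := hinf p fun d => pres.π.app d ≫ (e d).hom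
    let ψ : G.obj (Finset.univ.inf p) ⟶ X := pres.isLimit.lift
      { pt := _
        π :=
          { app d := G.map (homOfLE (Finset.inf_le (Finset.mem_univ d))) ≫ (e d).inv
            naturality _ _ _ := hsub' _ _ _ } }
    exact ⟨_, ⟨φ, ψ, pres.isLimit.hom_ext fun d => hsub' d _ _, hsub _ _ _⟩⟩

theorem isCoherentSubtopos_iff (J : GrothendieckTopology P) :
    IsCoherentSubtopos J ↔ IsFiniteTypeTopology J :=
  ⟨fun h => h.isFiniteTypeTopology, fun hJ =>
    ⟨isSheafModel_id.isCoherentTopos Adjunction.id isFiniteTypeTopology_bot,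
      (isSheafModel_sheafToPresheaf J).isCoherentTopos (sheafificationAdjunction J (Type u)) hJ,
      fun _ hF => isCoherentObject_presheafToSheaf hJ hF⟩⟩

end SemilatticeInf

end CoherentSubtopos

theorem mk_isCoherentSubtopos_finSubsetsRev (I : Type u) [Infinite I] :
    #{J : GrothendieckTopology (FinSubsetsRev I) // IsCoherentSubtopos J}
      = (2 : Cardinal.{u}) ^ #(FinSubsetsRev I) := by
  classical
  have : Infinite (FinSubsetsRev I) := inferInstanceAs (Infinite (Finset I))
  have h : ∀ J : GrothendieckTopology (FinSubsetsRev I),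
      IsCoherentSubtopos J ↔ IsFiniteTypeTopology J := isCoherentSubtopos_iff
  simp_rw [h]
  refine mk_isFiniteTypeTopology_le.antisymm ?_
  rw [← mk_lowerSet_finSubsetsRev]
  exact mk_le_of_injective (f := fun U : LowerSet (FinSubsetsRev I) =>
    (⟨closedTopology U, isFiniteTypeTopology_closedTopology U⟩ :
      {J : GrothendieckTopology (FinSubsetsRev I) // IsFiniteTypeTopology J}))
    fun U V h => closedTopology_injective (congrArg Subtype.val h)

theorem mainTheorem8 (I : Type u) [Infinite I] :
    (∃ e : Order.PFilter (FinSubsetsRev I) ≃o Set I,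
      ∀ x, e x = {i | ∃ p ∈ x, i ∈ OrderDual.ofDual p}) ∧
    #(Order.PFilter (FinSubsetsRev I)) = (2 : Cardinal.{u}) ^ #(FinSubsetsRev I) ∧
    #{J : GrothendieckTopology (FinSubsetsRev I) // IsClosedSubtopos J}
      = (2 : Cardinal.{u}) ^ #(FinSubsetsRev I) ∧
    #{J : GrothendieckTopology (FinSubsetsRev I) // IsCoherentSubtopos J}
      = (2 : Cardinal.{u}) ^ #(FinSubsetsRev I) ∧
    #{J : GrothendieckTopology (FinSubsetsRev I) //
        GrothendieckTopology.HasEnoughPoints.{u} J}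
      = (2 : Cardinal.{u}) ^ ((2 : Cardinal.{u}) ^ #(FinSubsetsRev I)) ∧
    #(GrothendieckTopology (FinSubsetsRev I))
      = (2 : Cardinal.{u}) ^ ((2 : Cardinal.{u}) ^ #(FinSubsetsRev I)) ∧
    (∃ A : Set (Set I), IsAntichain (· ⊆ ·) A ∧ #A = (2 : Cardinal.{u}) ^ #(FinSubsetsRev I)) ∧
    (∀ S : Set (Order.PFilter (FinSubsetsRev I)), IsUpperSet S →
      IsClosed[strongTopology (Topology.scott (Order.PFilter (FinSubsetsRev I)) Set.univ)] S) := by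
  obtain ⟨hep, hgt⟩ := mk_hasEnoughPoints_and_mk_grothendieckTopology I
  refine ⟨⟨pfilterFinSubsetsRevIso I, fun _ => rfl⟩, mk_pfilter_finSubsetsRev, ?_,
    mk_isCoherentSubtopos_finSubsetsRev I, hep, hgt, ?_,
    fun _ hS => hS.isClosed_strongTopology_scott⟩
  · rw [mk_isClosedSubtopos, mk_lowerSet_finSubsetsRev]
  · rw [mk_finSubsetsRev]
    exact exists_isAntichain_mk_eq I
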